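/- \textbf{Theorem (stability of SIFt-RLS).} Let $\lambda\in(0,1)$, $\varepsilon>0$, let $R_0\in\mathbb R^{n\times n}$ be positive definite, and let $\theta_0\in\mathbb R^n$. For every $k\ge 0$ let $\phi_k\in\mathbb R^{p\times n}$ be a regressor and $y_k\in\mathbb R^p$ a measurement, and assume that $(\phi_k)_{k\ge0}$ is bounded, i.e. there is $\beta>0$ with $\phi_k^{\rm T}\phi_k\preceq\beta I_n$ for all $k\ge 0$. Let $\phi_k=U_k\Sigma_kV_k^{\rm T}$ be a compact singular value decomposition with the singular values in descending order (so $U_k\in\mathbb R^{p\times\min\{p,n\}}$ and $V_k\in\mathbb R^{n\times\min\{p,n\}}$ have orthonormal columns), let $q_k$ be the number of diagonal entries of $\Sigma_k$ that are at least $\sqrt\varepsilon$, let $\bar U_k$ consist of the first $q_k$ columns of $U_k$, and put $$\bar\phi_k=\bar U_k^{\rm T}\phi_k\in\mathbb R^{q_k\times n},\qquad \bar y_k=\bar U_k^{\rm T}y_k\in\mathbb R^{q_k}.$$ For $k\ge0$ define recursively $$R_k^{\parallel}=R_k\bar\phi_k^{\rm T}(\bar\phi_kR_k\bar\phi_k^{\rm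 T})^{-1}\bar\phi_kR_k,\qquad R_k^{\perp}=R_k-R_k^{\parallel},\qquad \bar R_k=\lambda R_k^{\parallel}+R_k^{\perp},$$ $$R_{k+1}=\bar R_k+\bar\phi_k^{\rm T}\bar\phi_k,\qquad P_{k+1}=R_{k+1}^{-1},\qquad \theta_{k+1}=\theta_k+P_{k+1}\bar\phi_k^{\rm T}(\bar y_k-\bar\phi_k\theta_k).$$ Assume that there is $\theta\in\mathbb R^n$ with $y_k=\phi_k\theta$ for all $k\ge0$. Then the estimation error $\tilde\theta_k=\theta_k-\theta$ satisfies the linear time-varying system $$\tilde\theta_{k+1}=(I_n-P_{k+1}\bar\phi_k^{\rm T}\bar\phi_k)\,\tilde\theta_k,\qquad k\ge 0,\tag{E}$$ and the following hold. \begin{enumerate} \item The equilibrium $\tilde\theta_k\equiv0$ of (E) is uniformly Lyapunov stable: for every $\eta>0$ there is $\delta>0$ such that, for every initial time $k_0\ge0$, every solution $(x_k)_{k\ge k_0}$ of (E) with $\|x_{k_0}\|<\delta$ satisfies $\|x_k\|<\eta$ for all $k\ge k_0$. \item If $(\bar\phi_k)_{k\ge0}$ is persistently exciting, i.e. there are $N\ge1$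 and $\alpha_0>0$ with $\alpha_0I_n\preceq\sum_{i=k}^{k+N}\bar\phi_i^{\rm T}\bar\phi_i$ for all $k\ge0$, then the equilibrium $\tilde\theta_k\equiv0$ of (E) is globally uniformly exponentially stable: there are $\alpha>0$ and $b>1$ such that, for every $k_0\ge0$ and every solution $(x_k)_{k\ge k_0}$ of (E), $\|x_k\|\le\alpha\|x_{k_0}\|\,b^{-(k-k_0)}$ for all $k\ge k_0$. \end{enumerate} Here $\|\cdot\|$ is the Euclidean norm, and $A\preceq B$ means that $B-A$ is positive semidefinite. -/

import Mathlib

open scoped Matrix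

namespace SIFt

noncomputable section

/-! ### Compact singular value decompositions and information filtering -/

/-- A compact (economy-size) singular value decomposition `φ = U Σ Vᵀ` of a real `p × n` matrix:
`U` and `V` have `min p n` orthonormal columns, and `Σ` is diagonal with nonnegative entries in
descending order.  Such a decomposition is in general not unique. -/
structure CompactSVD {p n : ℕ} (φ : Matrix (Fin p) (Fin n) ℝ) where
  U : Matrix (Fin p) (Fin (min p n)) ℝ
  σ : Fin (min p n) → ℝ
  V : Matrix (Fin n) (Fin (min p n)) ℝ
  orthonormal_U : Uᵀ * U = 1
  orthonormal_V : Vᵀ * V = 1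
  nonneg_σ : ∀ i, 0 ≤ σ i
  antitone_σ : Antitone σ
  eq_mul : φ = U * Matrix.diagonal σ * Vᵀ

/-- The number `q` of singular values (with multiplicity) that are at least `√ε`. -/
def CompactSVD.numKept {p n : ℕ} {φ : Matrix (Fin p) (Fin n) ℝ} (S : CompactSVD φ) (ε : ℝ) : ℕ :=
  (Finset.univ.filter fun i => Real.sqrt ε ≤ S.σ i).card

theorem CompactSVD.numKept_le {p n : ℕ} {φ : Matrix (Fin p) (Fin n) ℝ} (S : CompactSVD φ)
    (ε : ℝ) : S.numKept ε ≤ min p n := by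
  have h := Finset.card_filter_le (Finset.univ : Finset (Fin (min p n)))
    (fun i => Real.sqrt ε ≤ S.σ i)
  simpa [CompactSVD.numKept] using h

/-- `Ū`: the first `q` columns of `U`. -/
def CompactSVD.keptU {p n : ℕ} {φ : Matrix (Fin p) (Fin n) ℝ} (S : CompactSVD φ) (ε : ℝ) :
    Matrix (Fin p) (Fin (S.numKept ε)) ℝ :=
  S.U.submatrix id (Fin.castLE (S.numKept_le ε))

/-- The filtered regressor `φ̄ = Ūᵀ φ`. -/
def filteredRegressor {p n : ℕ} {φ : Matrix (Fin p) (Fin n) ℝ} (S : CompactSVD φ) (ε : ℝ) :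
    Matrix (Fin (S.numKept ε)) (Fin n) ℝ :=
  (S.keptU ε)ᵀ * φ

/-- The filtered measurement `ȳ = Ūᵀ y`. -/
def filteredMeasurement {p n : ℕ} {φ : Matrix (Fin p) (Fin n) ℝ} (S : CompactSVD φ) (ε : ℝ)
    (y : EuclideanSpace ℝ (Fin p)) : EuclideanSpace ℝ (Fin (S.numKept ε)) :=
  Matrix.toEuclideanLin (S.keptU ε)ᵀ y

/-! ### Subspace decomposition of a positive-definite matrix -/

/-- The component `A v (vᵀ A v)⁻¹ vᵀ A` of `A` parallel to the subspace with basis the columns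
of `v`. -/
def parallelPart {n q : ℕ} (A : Matrix (Fin n) (Fin n) ℝ) (v : Matrix (Fin n) (Fin q) ℝ) :
    Matrix (Fin n) (Fin n) ℝ :=
  A * v * (vᵀ * A * v)⁻¹ * vᵀ * A

/-- The component of `A` orthogonal to the subspace with basis the columns of `v`. -/
def perpPart {n q : ℕ} (A : Matrix (Fin n) (Fin n) ℝ) (v : Matrix (Fin n) (Fin q) ℝ) :
    Matrix (Fin n) (Fin n) ℝ :=
  A - parallelPart A v

/-! ### The SIFt-RLS recursion -/

/-- The SIFted information matrix `R̄ = lam R^∥ + R^⊥`, where the decomposition of `R` is with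
respect to the row space of the filtered regressor `φbar`. -/
def siftedInformation {n q : ℕ} (lam : ℝ) (R : Matrix (Fin n) (Fin n) ℝ)
    (φbar : Matrix (Fin q) (Fin n) ℝ) : Matrix (Fin n) (Fin n) ℝ :=
  lam • parallelPart R φbarᵀ + perpPart R φbarᵀ

/-- The information matrices `R_k`: they start at `R₀`, and `R_{k+1} = R̄_k + φ̄_kᵀ φ̄_k`. -/
def information {n : ℕ} {q : ℕ → ℕ} (lam : ℝ) (R₀ : Matrix (Fin n) (Fin n) ℝ)
    (φbar : ∀ k, Matrix (Fin (q k)) (Fin n) ℝ) : ℕ → Matrix (Fin n) (Fin n) ℝ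
  | 0 => R₀
  | k + 1 => siftedInformation lam (information lam R₀ φbar k) (φbar k) + (φbar k)ᵀ * φbar k

/-- The covariance matrices `P_k = R_k⁻¹`. -/
def covariance {n : ℕ} {q : ℕ → ℕ} (lam : ℝ) (R₀ : Matrix (Fin n) (Fin n) ℝ)
    (φbar : ∀ k, Matrix (Fin (q k)) (Fin n) ℝ) (k : ℕ) : Matrix (Fin n) (Fin n) ℝ :=
  (information lam R₀ φbar k)⁻¹

/-- The parameter estimates `θ_k`: they start at `θ₀`, and
`θ_{k+1} = θ_k + P_{k+1} φ̄_kᵀ (ȳ_k - φ̄_k θ_k)`. -/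
def estimate {n : ℕ} {q : ℕ → ℕ} (lam : ℝ) (R₀ : Matrix (Fin n) (Fin n) ℝ)
    (φbar : ∀ k, Matrix (Fin (q k)) (Fin n) ℝ) (ybar : ∀ k, EuclideanSpace ℝ (Fin (q k)))
    (θ₀ : EuclideanSpace ℝ (Fin n)) : ℕ → EuclideanSpace ℝ (Fin n)
  | 0 => θ₀
  | k + 1 =>
    estimate lam R₀ φbar ybar θ₀ k +
      Matrix.toEuclideanLin (covariance lam R₀ φbar (k + 1) * (φbar k)ᵀ)
        (ybar k - Matrix.toEuclideanLin (φbar k) (estimate lam R₀ φbar ybar θ₀ k))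

/-- The right-hand side of the error system
`x_{k+1} = (I - P_{k+1} φ̄_kᵀ φ̄_k) x_k`, as a time-varying map. -/
def errorMap {n : ℕ} {q : ℕ → ℕ} (lam : ℝ) (R₀ : Matrix (Fin n) (Fin n) ℝ)
    (φbar : ∀ k, Matrix (Fin (q k)) (Fin n) ℝ) (k : ℕ) (x : EuclideanSpace ℝ (Fin n)) :
    EuclideanSpace ℝ (Fin n) :=
  Matrix.toEuclideanLin (1 - covariance lam R₀ φbar (k + 1) * (φbar k)ᵀ * φbar k) x

/-! ### Excitation conditions (`A ⪯ B` means that `B - A` is positive semidefinite) -/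

/-- Persistent excitation, for matrices with `n` columns and possibly varying numbers of rows:
`α I ⪯ ∑_{i=k}^{k+N} φ_iᵀ φ_i` for all `k`, for some `N ≥ 1` and `α > 0`. -/
def PersistentlyExciting {n : ℕ} {q : ℕ → ℕ} (φ : ∀ k, Matrix (Fin (q k)) (Fin n) ℝ) : Prop :=
  ∃ N : ℕ, 1 ≤ N ∧ ∃ α : ℝ, 0 < α ∧ ∀ k : ℕ,
    ((∑ i ∈ Finset.Icc k (k + N), (φ i)ᵀ * φ i) -
      α • (1 : Matrix (Fin n) (Fin n) ℝ)).PosSemidef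

/-- Boundedness of a sequence of regressors: `φ_kᵀ φ_k ⪯ β I` for all `k`, for some `β > 0`. -/
def BoundedRegressors {p n : ℕ} (φ : ℕ → Matrix (Fin p) (Fin n) ℝ) : Prop :=
  ∃ β : ℝ, 0 < β ∧ ∀ k : ℕ,
    (β • (1 : Matrix (Fin n) (Fin n) ℝ) - (φ k)ᵀ * φ k).PosSemidef

/-! ### Stability of the zero equilibrium of `x_{k+1} = f k (x_k)` -/

/-- `x` satisfies `x_{k+1} = f k (x_k)` from the initial time `k₀` on. -/
def IsTrajectoryFrom {E : Type*} (f : ℕ → E → E) (k₀ : ℕ) (x : ℕ → E) : Prop :=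
  ∀ k, k₀ ≤ k → x (k + 1) = f k (x k)

/-- Zero is an equilibrium that is Lyapunov stable uniformly in the initial time. -/
def UniformlyLyapunovStable {E : Type*} [NormedAddCommGroup E] (f : ℕ → E → E) : Prop :=
  (∀ k, f k 0 = 0) ∧
  ∀ η : ℝ, 0 < η → ∃ δ : ℝ, 0 < δ ∧
    ∀ (k₀ : ℕ) (x : ℕ → E), IsTrajectoryFrom f k₀ x → ‖x k₀‖ < δ → ∀ k, k₀ ≤ k → ‖x k‖ < η

/-- Zero is a globally exponentially stable equilibrium, with constants that depend neither on
the initial time nor on the initial state. -/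
def GloballyUniformlyExponentiallyStable {E : Type*} [NormedAddCommGroup E]
    (f : ℕ → E → E) : Prop :=
  (∀ k, f k 0 = 0) ∧
  ∃ α : ℝ, 0 < α ∧ ∃ b : ℝ, 1 < b ∧
    ∀ (k₀ : ℕ) (x : ℕ → E), IsTrajectoryFrom f k₀ x →
      ∀ k, k₀ ≤ k → ‖x k‖ ≤ α * ‖x k₀‖ * (b ^ (k - k₀))⁻¹

end

end SIFt

/-! Truncating the SVD makes `φ̄ φ̄ᵀ` diagonal with all entries at least `ε`, so `φ̄` is well
conditioned on its own row space. The perpendicular part of `R` is a Schur complement: its form at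
`x` is the minimum over `u` of the form of `R` at `x - φ̄ᵀ u`. Hence `0 ≤ R^⊥ ≤ R` and `lam R ≤ R̄ ≤
R`. Forgetting acts only along directions that the new data refill, so `R_k` stays between `a I` and
`c I` without excitation (`le_update`, `update_le`, `information_bounds`).

Thus `V_k(x) = xᵀ R_k x` is uniformly comparable to `‖x‖²`. One error step `y` solves `R_{k+1} y =
R̄_k x`, which gives the exact balance `V_{k+1}(y) + ‖φ̄ y‖² + (x - y)ᵀ R̄ (x - y) = xᵀ R̄ x ≤
V_k(x)` (`lyapunov_decrease`); stability follows.

Under persistent excitation, a small drop of `V` over a window forces small outputs and small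
increments, so every output of the window, evaluated at the window's initial state, is small.
Excitation then bounds that state by the drop, and `V` contracts by a fixed factor
(`exponentiallyStable_of_excitation`). -/

namespace SIFt

/-! ### One update: Schur complement, eigenvalue bounds, Lyapunov balance. -/

section OneStep

variable {n q : ℕ} {R : Matrix (Fin n) (Fin n) ℝ} {φ : Matrix (Fin q) (Fin n) ℝ} {d : Fin q → ℝ}

theorem isSymm_of_posDef (hR : R.PosDef) : R.IsSymm := by
  rw [Matrix.IsSymm, ← Matrix.conjTranspose_eq_transpose_of_trivial, hR.isHermitian.eq]

theorem posDef_of_coercive (hR : R.IsSymm) {a : ℝ} (ha : 0 < a)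
    (h : ∀ x, a * (x ⬝ᵥ x) ≤ x ⬝ᵥ R *ᵥ x) : R.PosDef := by
  refine Matrix.PosDef.of_dotProduct_mulVec_pos (by rw [Matrix.IsHermitian, Matrix.conjTranspose_eq_transpose_of_trivial, hR.eq]) ?_
  intro x hx
  have h1 : 0 < x ⬝ᵥ x := by
    have := Matrix.dotProduct_star_self_pos_iff.mpr hx
    simpa using this
  have := h x
  simpa using lt_of_lt_of_le (mul_pos ha h1) this

theorem dotProduct_self_mulVec (φ : Matrix (Fin q) (Fin n) ℝ) (x : Fin n → ℝ) :
    x ⬝ᵥ (φᵀ * φ) *ᵥ x = (φ *ᵥ x) ⬝ᵥ (φ *ᵥ x) := by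
  rw [← Matrix.mulVec_mulVec, Matrix.dotProduct_mulVec, Matrix.vecMul_transpose]

theorem transpose_mulVec_dotProduct (φ : Matrix (Fin q) (Fin n) ℝ) (u : Fin q → ℝ)
    (x : Fin n → ℝ) : (φᵀ *ᵥ u) ⬝ᵥ x = u ⬝ᵥ φ *ᵥ x := by
  rw [Matrix.dotProduct_mulVec, Matrix.mulVec_transpose]

theorem dotProduct_mulVec_symm (hR : R.IsSymm) (x y : Fin n → ℝ) :
    x ⬝ᵥ R *ᵥ y = y ⬝ᵥ R *ᵥ x := by
  rw [Matrix.dotProduct_mulVec, dotProduct_comm, ← Matrix.mulVec_transpose, hR.eq]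

theorem dotProduct_self_nonneg' (x : Fin n → ℝ) : 0 ≤ x ⬝ᵥ x := 
  Finset.sum_nonneg fun i _ => mul_self_nonneg (x i)

theorem mulVec_transpose_injective (hφ : φ * φᵀ = Matrix.diagonal d) (hd : ∀ i, 0 < d i) :
    Function.Injective φᵀ.mulVec := by
  intro u v huv
  have h : (φ * φᵀ) *ᵥ u = (φ * φᵀ) *ᵥ v := by
    rw [← Matrix.mulVec_mulVec, ← Matrix.mulVec_mulVec]
    exact congrArg _ huv
  rw [hφ] at h
  ext i
  have hi := congrFun h i
  rw [Matrix.mulVec_diagonal, Matrix.mulVec_diagonal] at hi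
  exact mul_left_cancel₀ (hd i).ne' hi

theorem isUnit_det_compression (hR : R.PosDef) (hφ : Function.Injective φᵀ.mulVec) :
    IsUnit (φ * R * φᵀ).det := by
  have h := hR.conjTranspose_mul_mul_same hφ
  rw [Matrix.conjTranspose_eq_transpose_of_trivial, Matrix.transpose_transpose] at h
  exact (Matrix.isUnit_iff_isUnit_det _).mp h.isUnit

theorem isSymm_perpPart (hR : R.IsSymm) : (perpPart R φᵀ).IsSymm := by
  have hG : ((φ * R * φᵀ)⁻¹)ᵀ = (φ * R * φᵀ)⁻¹ := by
    rw [Matrix.transpose_nonsing_inv]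
    congr 1
    simp [Matrix.transpose_mul, hR.eq, Matrix.mul_assoc]
  unfold perpPart parallelPart
  rw [Matrix.transpose_transpose]
  refine hR.sub ?_
  unfold Matrix.IsSymm
  generalize (φ * R * φᵀ)⁻¹ = G at hG ⊢
  simp only [Matrix.transpose_mul, Matrix.transpose_transpose, hG, hR.eq, Matrix.mul_assoc]

/-- The quadratic form of the perpendicular part is attained by the form of `R` at the
`R`-orthogonal projection of `x` along the row space of `φ`. -/
theorem exists_perpPart_eq (hR : R.PosDef) (hφ : Function.Injective φᵀ.mulVec)
    (x : Fin n → ℝ) :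
    ∃ u : Fin q → ℝ, φ *ᵥ (R *ᵥ (x - φᵀ *ᵥ u)) = 0 ∧
      x ⬝ᵥ perpPart R φᵀ *ᵥ x = (x - φᵀ *ᵥ u) ⬝ᵥ R *ᵥ (x - φᵀ *ᵥ u) := by
  have hG := isUnit_det_compression hR hφ
  set G := φ * R * φᵀ with hGdef
  -- The solution of the normal equations `φ R φᵀ u = φ R x`.
  let u := G⁻¹ *ᵥ (φ *ᵥ (R *ᵥ x))
  have h0 : φ *ᵥ (R *ᵥ (x - φᵀ *ᵥ u)) = 0 := by
    have : φ *ᵥ (R *ᵥ (φᵀ *ᵥ u)) = φ *ᵥ (R *ᵥ x) := by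
      rw [Matrix.mulVec_mulVec, Matrix.mulVec_mulVec, ← hGdef, Matrix.mulVec_mulVec,
        Matrix.mul_nonsing_inv _ hG, Matrix.one_mulVec]
    rw [Matrix.mulVec_sub, Matrix.mulVec_sub, this, sub_self]
  have h1 : perpPart R φᵀ *ᵥ x = R *ᵥ (x - φᵀ *ᵥ u) := by
    simp only [perpPart, parallelPart, Matrix.transpose_transpose, u, Matrix.sub_mulVec,
      Matrix.mulVec_sub, Matrix.mulVec_mulVec, Matrix.mul_assoc, G]
  refine ⟨u, h0, ?_⟩
  rw [h1, sub_dotProduct, transpose_mulVec_dotProduct, h0, dotProduct_zero, sub_zero]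

/-- Minimality of the `R`-orthogonal projection: any other competitor differs from it by a row-space
vector, the cross term vanishes, and the remaining square is nonnegative. -/
theorem perpPart_le (hR : R.PosDef) (hφ : Function.Injective φᵀ.mulVec)
    (x : Fin n → ℝ) (w : Fin q → ℝ) :
    x ⬝ᵥ perpPart R φᵀ *ᵥ x ≤ (x - φᵀ *ᵥ w) ⬝ᵥ R *ᵥ (x - φᵀ *ᵥ w) := by
  obtain ⟨u, h0, h1⟩ := exists_perpPart_eq hR hφ x
  have hs : R.IsSymm := isSymm_of_posDef hR
  have hz : x - φᵀ *ᵥ w = (x - φᵀ *ᵥ u) + φᵀ *ᵥ (u - w) := by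
    rw [Matrix.mulVec_sub]; abel
  have hn : 0 ≤ (φᵀ *ᵥ (u - w)) ⬝ᵥ R *ᵥ (φᵀ *ᵥ (u - w)) := by
    simpa using hR.posSemidef.dotProduct_mulVec_nonneg (φᵀ *ᵥ (u - w))
  rw [h1, hz]
  generalize x - φᵀ *ᵥ u = z at *
  rw [Matrix.mulVec_add, add_dotProduct, dotProduct_add, dotProduct_add,
    dotProduct_mulVec_symm hs z (φᵀ *ᵥ _), transpose_mulVec_dotProduct φ (u - w) (R *ᵥ z), h0,
    dotProduct_zero]
  linarith

theorem perpPart_nonneg (hR : R.PosDef) (hφ : Function.Injective φᵀ.mulVec) (x : Fin n → ℝ) :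
    0 ≤ x ⬝ᵥ perpPart R φᵀ *ᵥ x := by
  obtain ⟨u, -, h1⟩ := exists_perpPart_eq hR hφ x
  rw [h1]
  simpa using hR.posSemidef.dotProduct_mulVec_nonneg (x - φᵀ *ᵥ u)

theorem siftedInformation_eq (lam : ℝ) (R : Matrix (Fin n) (Fin n) ℝ)
    (φ : Matrix (Fin q) (Fin n) ℝ) :
    siftedInformation lam R φ = lam • R + (1 - lam) • perpPart R φᵀ := by
  simp only [siftedInformation, perpPart]
  module

theorem isSymm_siftedInformation (lam : ℝ) (hR : R.IsSymm) :
    (siftedInformation lam R φ).IsSymm := by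
  rw [siftedInformation_eq]
  exact (hR.smul _).add ((isSymm_perpPart hR).smul _)

theorem siftedInformation_form (lam : ℝ) (x : Fin n → ℝ) :
    x ⬝ᵥ siftedInformation lam R φ *ᵥ x =
      lam * (x ⬝ᵥ R *ᵥ x) + (1 - lam) * (x ⬝ᵥ perpPart R φᵀ *ᵥ x) := by
  rw [siftedInformation_eq, Matrix.add_mulVec, Matrix.smul_mulVec, Matrix.smul_mulVec,
    dotProduct_add, dotProduct_smul, dotProduct_smul, smul_eq_mul, smul_eq_mul]

theorem siftedInformation_le {lam : ℝ} (hlam : lam ∈ Set.Ioo (0 : ℝ) 1) (hR : R.PosDef)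
    (hφ : Function.Injective φᵀ.mulVec) (x : Fin n → ℝ) :
    x ⬝ᵥ siftedInformation lam R φ *ᵥ x ≤ x ⬝ᵥ R *ᵥ x := by
  have h := perpPart_le hR hφ x 0
  rw [Matrix.mulVec_zero, sub_zero] at h
  rw [siftedInformation_form]
  nlinarith [hlam.2]

theorem le_siftedInformation {lam : ℝ} (hlam : lam ∈ Set.Ioo (0 : ℝ) 1) (hR : R.PosDef)
    (hφ : Function.Injective φᵀ.mulVec) (x : Fin n → ℝ) :
    lam * (x ⬝ᵥ R *ᵥ x) ≤ x ⬝ᵥ siftedInformation lam R φ *ᵥ x := by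
  rw [siftedInformation_form]
  nlinarith [perpPart_nonneg hR hφ x, hlam.2]

/-- Orthogonal decomposition of a vector with respect to the row space of `φ`. -/
theorem exists_rowSpace_decomposition (hφ : φ * φᵀ = Matrix.diagonal d) (hd : ∀ i, 0 < d i)
    (x : Fin n → ℝ) : ∃ w : Fin q → ℝ, φ *ᵥ (x - φᵀ *ᵥ w) = 0 := by
  refine ⟨fun i => (φ *ᵥ x) i / d i, ?_⟩
  rw [Matrix.mulVec_sub, Matrix.mulVec_mulVec, hφ, sub_eq_zero]
  ext i
  rw [Matrix.mulVec_diagonal, mul_div_cancel₀ _ (hd i).ne']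

theorem dotProduct_self_of_decomposition {x : Fin n → ℝ} {w : Fin q → ℝ}
    (h : φ *ᵥ (x - φᵀ *ᵥ w) = 0) (u : Fin q → ℝ) :
    (x - φᵀ *ᵥ u) ⬝ᵥ (x - φᵀ *ᵥ u) = (x - φᵀ *ᵥ w) ⬝ᵥ (x - φᵀ *ᵥ w) +
      (φᵀ *ᵥ (w - u)) ⬝ᵥ (φᵀ *ᵥ (w - u)) := by
  have hz : x - φᵀ *ᵥ u = (x - φᵀ *ᵥ w) + φᵀ *ᵥ (w - u) := by
    rw [Matrix.mulVec_sub]; abel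
  rw [hz]
  generalize x - φᵀ *ᵥ w = z at *
  rw [add_dotProduct, dotProduct_add, dotProduct_add, dotProduct_comm z (φᵀ *ᵥ _),
    transpose_mulVec_dotProduct φ (w - u) z, h, dotProduct_zero]
  ring

/-- In the coordinates `w` both sides are diagonal, and the claim is `ε d_i w_i² ≤ d_i² w_i²`
termwise. -/
theorem le_mulVec_transpose {ε : ℝ} (hφ : φ * φᵀ = Matrix.diagonal d) (hε : 0 < ε)
    (hd : ∀ i, ε ≤ d i) (w : Fin q → ℝ) :
    ε * ((φᵀ *ᵥ w) ⬝ᵥ (φᵀ *ᵥ w)) ≤ (φ *ᵥ (φᵀ *ᵥ w)) ⬝ᵥ (φ *ᵥ (φᵀ *ᵥ w)) := by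
  rw [transpose_mulVec_dotProduct, Matrix.mulVec_mulVec, hφ]
  simp only [dotProduct, Matrix.mulVec_diagonal, Finset.mul_sum]
  refine Finset.sum_le_sum fun i _ => ?_
  have h1 : 0 ≤ d i * (w i * w i) := mul_nonneg (hε.le.trans (hd i)) (mul_self_nonneg _)
  nlinarith [mul_le_mul_of_nonneg_right (hd i) h1]

theorem update_form (lam : ℝ) (x : Fin n → ℝ) :
    x ⬝ᵥ (siftedInformation lam R φ + φᵀ * φ) *ᵥ x =
      lam * (x ⬝ᵥ R *ᵥ x) + (1 - lam) * (x ⬝ᵥ perpPart R φᵀ *ᵥ x) + (φ *ᵥ x) ⬝ᵥ (φ *ᵥ x) := by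
  rw [Matrix.add_mulVec, dotProduct_add, siftedInformation_form, dotProduct_self_mulVec]

/-- Split `x = z + φᵀ w` orthogonally. The `R^⊥` term controls `z`, since no shift along the row
space makes `x` shorter than `z`; the data term controls `φᵀ w` with constant `ε`, which replaces
the forgotten `(1 - lam) a`. -/
theorem le_update {lam ε a : ℝ} (hlam : lam ∈ Set.Ioo (0 : ℝ) 1)
    (hφ : φ * φᵀ = Matrix.diagonal d) (hε : 0 < ε) (hd : ∀ i, ε ≤ d i) (ha : 0 < a)
    (haε : (1 - lam) * a ≤ ε) (hs : R.IsSymm) (hR : ∀ x, a * (x ⬝ᵥ x) ≤ x ⬝ᵥ R *ᵥ x)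
    (x : Fin n → ℝ) :
    a * (x ⬝ᵥ x) ≤ x ⬝ᵥ (siftedInformation lam R φ + φᵀ * φ) *ᵥ x := by
  have hd0 : ∀ i, 0 < d i := fun i => hε.trans_le (hd i)
  obtain ⟨w, hw⟩ := exists_rowSpace_decomposition hφ hd0 x
  obtain ⟨u, -, hu⟩ := exists_perpPart_eq (posDef_of_coercive hs ha hR)
    (mulVec_transpose_injective hφ hd0) x
  have h1 := dotProduct_self_of_decomposition hw u
  have h0 := dotProduct_self_of_decomposition hw 0
  rw [Matrix.mulVec_zero, sub_zero, sub_zero] at h0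
  have h2 := le_mulVec_transpose hφ hε hd w
  have h3 : φ *ᵥ (φᵀ *ᵥ w) = φ *ᵥ x := by
    rw [Matrix.mulVec_sub, sub_eq_zero] at hw
    exact hw.symm
  rw [h3] at h2
  rw [update_form, hu]
  have h4 := hR (x - φᵀ *ᵥ u)
  have h5 := hR x
  have h6 := dotProduct_self_nonneg' (φᵀ *ᵥ (w - u))
  have h7 := dotProduct_self_nonneg' (φᵀ *ᵥ w)
  have hl := hlam.1
  have hl' : 0 < 1 - lam := sub_pos.mpr hlam.2
  have e1 := mul_le_mul_of_nonneg_left h5 hl.le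
  have e2 := mul_le_mul_of_nonneg_left h4 hl'.le
  rw [h1] at e2
  rw [h0] at e1 ⊢
  have e3 := mul_le_mul_of_nonneg_right haε h7
  have e4 : 0 ≤ (1 - lam) * (a * ((φᵀ *ᵥ (w - u)) ⬝ᵥ (φᵀ *ᵥ (w - u)))) := by positivity
  linarith

/-- Same splitting, with the Euclidean projection as a competitor in the minimum defining `R^⊥`. The
data add at most `β ≤ (1 - lam) c` on the row space, where forgetting has freed that much. -/
theorem update_le {lam β c : ℝ} (hlam : lam ∈ Set.Ioo (0 : ℝ) 1)
    (hφ : φ * φᵀ = Matrix.diagonal d) (hd : ∀ i, 0 < d i)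
    (hβ : ∀ x, (φ *ᵥ x) ⬝ᵥ (φ *ᵥ x) ≤ β * (x ⬝ᵥ x))
    (hc : β ≤ (1 - lam) * c) (hR : R.PosDef) (hRc : ∀ x, x ⬝ᵥ R *ᵥ x ≤ c * (x ⬝ᵥ x))
    (x : Fin n → ℝ) :
    x ⬝ᵥ (siftedInformation lam R φ + φᵀ * φ) *ᵥ x ≤ c * (x ⬝ᵥ x) := by
  obtain ⟨w, hw⟩ := exists_rowSpace_decomposition hφ hd x
  have hp := perpPart_le hR (mulVec_transpose_injective hφ hd) x w
  have h0 := dotProduct_self_of_decomposition hw 0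
  rw [Matrix.mulVec_zero, sub_zero, sub_zero] at h0
  have h2 := hβ (φᵀ *ᵥ w)
  have h3 : φ *ᵥ (φᵀ *ᵥ w) = φ *ᵥ x := by
    rw [Matrix.mulVec_sub, sub_eq_zero] at hw
    exact hw.symm
  rw [h3] at h2
  rw [update_form]
  have hl := hlam.1
  have hl' : 0 < 1 - lam := sub_pos.mpr hlam.2
  have e1 := mul_le_mul_of_nonneg_left (hRc x) hl.le
  have e2 := mul_le_mul_of_nonneg_left (hp.trans (hRc _)) hl'.le
  have e3 := mul_le_mul_of_nonneg_right hc (dotProduct_self_nonneg' (φᵀ *ᵥ w))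
  rw [h0] at e1 ⊢
  linarith

/-- Decrease of the quadratic Lyapunov function along one step of the error system. -/
theorem lyapunov_decrease {lam a : ℝ} (hlam : lam ∈ Set.Ioo (0 : ℝ) 1)
    (hφ : Function.Injective φᵀ.mulVec) (ha : 0 < a) (hs : R.IsSymm)
    (hR : ∀ x, a * (x ⬝ᵥ x) ≤ x ⬝ᵥ R *ᵥ x)
    (hdet : IsUnit (siftedInformation lam R φ + φᵀ * φ).det) {x y : Fin n → ℝ}
    (hy : y = (1 - (siftedInformation lam R φ + φᵀ * φ)⁻¹ * φᵀ * φ) *ᵥ x) :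
    y ⬝ᵥ (siftedInformation lam R φ + φᵀ * φ) *ᵥ y + (φ *ᵥ y) ⬝ᵥ (φ *ᵥ y) +
      lam * a * ((x - y) ⬝ᵥ (x - y)) ≤ x ⬝ᵥ R *ᵥ x := by
  have hpd := posDef_of_coercive hs ha hR
  have hle := siftedInformation_le hlam hpd hφ x
  have hge := le_siftedInformation hlam hpd hφ (x - y)
  have hS : (siftedInformation lam R φ).IsSymm := isSymm_siftedInformation lam hs
  generalize siftedInformation lam R φ = B at *
  -- This identity turns the form at `y` into the cross term `yᵀ B x`; expanding the square of `x -
  -- y` in `B` then eliminates it.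
  have h1 : (B + φᵀ * φ) *ᵥ y = B *ᵥ x := by
    rw [hy, Matrix.mulVec_mulVec, Matrix.mul_sub, Matrix.mul_one, Matrix.mul_assoc _⁻¹,
      ← Matrix.mul_assoc _ _⁻¹, Matrix.mul_nonsing_inv _ hdet, Matrix.one_mul, add_sub_cancel_right]
  have h3 : y ⬝ᵥ (B + φᵀ * φ) *ᵥ y = y ⬝ᵥ B *ᵥ x := by rw [h1]
  have h3' := h3
  rw [Matrix.add_mulVec, dotProduct_add, dotProduct_self_mulVec] at h3'
  have h4 : (x - y) ⬝ᵥ B *ᵥ (x - y) = x ⬝ᵥ B *ᵥ x - 2 * (y ⬝ᵥ B *ᵥ x) + y ⬝ᵥ B *ᵥ y := by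
    rw [Matrix.mulVec_sub, sub_dotProduct, dotProduct_sub, dotProduct_sub,
      dotProduct_mulVec_symm hS x y]
    ring
  have h5 := mul_le_mul_of_nonneg_left (hR (x - y)) hlam.1.le
  rw [h3]
  linarith

end OneStep

/-! ### Conditioning of the filtered regressor. -/

section FilteredRegressor

variable {p n : ℕ} {φ : Matrix (Fin p) (Fin n) ℝ}

/-- Descending order enters here: if the value at `i` fell below the threshold, all values that pass
would have index below `i`, so at most `i` would be counted. -/
theorem CompactSVD.sqrt_le_σ_castLE (S : CompactSVD φ) (ε : ℝ) (i : Fin (S.numKept ε)) :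
    Real.sqrt ε ≤ S.σ (Fin.castLE (S.numKept_le ε) i) := by
  by_contra h
  have hsub : (Finset.univ.filter fun j => Real.sqrt ε ≤ S.σ j) ⊆
      Finset.Iio (Fin.castLE (S.numKept_le ε) i) := by
    intro j hj
    rw [Finset.mem_filter] at hj
    rw [Finset.mem_Iio]
    by_contra hij
    exact h (hj.2.trans (S.antitone_σ (not_lt.mp hij)))
  have hcard := Finset.card_le_card hsub
  rw [Fin.card_Iio] at hcard
  exact absurd i.isLt (not_lt.mpr hcard)

theorem CompactSVD.keptU_orthonormal (S : CompactSVD φ) (ε : ℝ) :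
    (S.keptU ε)ᵀ * S.keptU ε = 1 := by
  have h : (S.keptU ε)ᵀ * S.keptU ε = (S.Uᵀ * S.U).submatrix (Fin.castLE (S.numKept_le ε))
      (Fin.castLE (S.numKept_le ε)) := by
    ext i j
    simp [CompactSVD.keptU, Matrix.mul_apply]
  rw [h, S.orthonormal_U, Matrix.submatrix_one _ (Fin.castLE_injective _)]

theorem filteredRegressor_eq (S : CompactSVD φ) (ε : ℝ) :
    filteredRegressor S ε =
      (Matrix.diagonal S.σ * S.Vᵀ).submatrix (Fin.castLE (S.numKept_le ε)) id := by
  have h : filteredRegressor S ε = (S.Uᵀ * φ).submatrix (Fin.castLE (S.numKept_le ε)) id := by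
    ext i j
    simp [filteredRegressor, CompactSVD.keptU, Matrix.mul_apply]
  have h' : S.Uᵀ * φ = Matrix.diagonal S.σ * S.Vᵀ :=
    calc S.Uᵀ * φ = S.Uᵀ * (S.U * Matrix.diagonal S.σ * S.Vᵀ) := congrArg (S.Uᵀ * ·) S.eq_mul
      _ = Matrix.diagonal S.σ * S.Vᵀ := by
        rw [Matrix.mul_assoc S.U, ← Matrix.mul_assoc, S.orthonormal_U, Matrix.one_mul]
  rw [h, h']

theorem filteredRegressor_mul_transpose (S : CompactSVD φ) (ε : ℝ) :
    filteredRegressor S ε * (filteredRegressor S ε)ᵀ =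
      Matrix.diagonal fun i => S.σ (Fin.castLE (S.numKept_le ε) i) ^ 2 := by
  have h : filteredRegressor S ε * (filteredRegressor S ε)ᵀ =
      ((Matrix.diagonal S.σ * S.Vᵀ) * (Matrix.diagonal S.σ * S.Vᵀ)ᵀ).submatrix
        (Fin.castLE (S.numKept_le ε)) (Fin.castLE (S.numKept_le ε)) := by
    rw [filteredRegressor_eq]
    ext i j
    simp [Matrix.mul_apply]
  rw [h, Matrix.transpose_mul, Matrix.transpose_transpose, Matrix.diagonal_transpose,
    Matrix.mul_assoc, ← Matrix.mul_assoc S.Vᵀ, S.orthonormal_V, Matrix.one_mul,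
    Matrix.diagonal_mul_diagonal, Matrix.submatrix_diagonal _ _ (Fin.castLE_injective _)]
  congr 1
  ext i
  simp [sq]

theorem le_sq_σ_castLE (S : CompactSVD φ) (ε : ℝ) (i : Fin (S.numKept ε)) :
    ε ≤ S.σ (Fin.castLE (S.numKept_le ε) i) ^ 2 :=
  (Real.sqrt_le_left (S.nonneg_σ _)).mp (S.sqrt_le_σ_castLE ε i)

/-- Bessel's inequality: Pythagoras for the projection `U Uᵀ v`. -/
theorem transpose_mulVec_self_le {q : ℕ} {U : Matrix (Fin p) (Fin q) ℝ} (hU : Uᵀ * U = 1)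
    (v : Fin p → ℝ) : (Uᵀ *ᵥ v) ⬝ᵥ (Uᵀ *ᵥ v) ≤ v ⬝ᵥ v := by
  have hw : Uᵀ *ᵥ (v - Uᵀᵀ *ᵥ (Uᵀ *ᵥ v)) = 0 := by
    rw [Matrix.transpose_transpose, Matrix.mulVec_sub, Matrix.mulVec_mulVec, hU,
      Matrix.one_mulVec, sub_self]
  have h := dotProduct_self_of_decomposition hw 0
  rw [Matrix.mulVec_zero, sub_zero, sub_zero, transpose_mulVec_dotProduct,
    Matrix.transpose_transpose, Matrix.mulVec_mulVec _ Uᵀ U, hU, Matrix.one_mulVec] at h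
  linarith [dotProduct_self_nonneg' (v - U *ᵥ (Uᵀ *ᵥ v))]

theorem filteredRegressor_mulVec_le (S : CompactSVD φ) (ε : ℝ) {β : ℝ}
    (hβ : (β • (1 : Matrix (Fin n) (Fin n) ℝ) - φᵀ * φ).PosSemidef) (x : Fin n → ℝ) :
    (filteredRegressor S ε *ᵥ x) ⬝ᵥ (filteredRegressor S ε *ᵥ x) ≤ β * (x ⬝ᵥ x) := by
  have h1 := transpose_mulVec_self_le (S.keptU_orthonormal ε) (φ *ᵥ x)
  have h2 := hβ.dotProduct_mulVec_nonneg x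
  rw [star_trivial, Matrix.sub_mulVec, dotProduct_sub, Matrix.smul_mulVec, Matrix.one_mulVec,
    dotProduct_smul, dotProduct_self_mulVec, smul_eq_mul] at h2
  rw [Matrix.mulVec_mulVec] at h1
  exact h1.trans (by linarith)

end FilteredRegressor

/-! ### Uniform bounds on the information matrices. -/

section Information

variable {n : ℕ}

theorem dotProduct_self_eq_norm_sq (x : EuclideanSpace ℝ (Fin n)) :
    x.ofLp ⬝ᵥ x.ofLp = ‖x‖ ^ 2 := by
  rw [EuclideanSpace.real_norm_sq_eq]
  simp [dotProduct, sq]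

theorem exists_form_le (R : Matrix (Fin n) (Fin n) ℝ) :
    ∃ c : ℝ, 0 < c ∧ ∀ x, x ⬝ᵥ R *ᵥ x ≤ c * (x ⬝ᵥ x) := by
  let T := (Matrix.toEuclideanLin R).toContinuousLinearMap
  refine ⟨‖T‖ + 1, by positivity, fun x => ?_⟩
  let z : EuclideanSpace ℝ (Fin n) := WithLp.toLp 2 x
  have h1 : x ⬝ᵥ R *ᵥ x = inner ℝ (T z) z := by
    simp [T, z, EuclideanSpace.inner_eq_star_dotProduct]
  have h2 : x ⬝ᵥ x = ‖z‖ ^ 2 := dotProduct_self_eq_norm_sq z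
  rw [h1, h2]
  have h3 := real_inner_le_norm (T z) z
  have h4 := mul_le_mul_of_nonneg_right (T.le_opNorm z) (norm_nonneg z)
  nlinarith [sq_nonneg ‖z‖]

open scoped MatrixOrder in
theorem exists_le_form {R : Matrix (Fin n) (Fin n) ℝ} (hR : R.PosDef) :
    ∃ a : ℝ, 0 < a ∧ ∀ x, a * (x ⬝ᵥ x) ≤ x ⬝ᵥ R *ᵥ x := by
  obtain ⟨B, hB⟩ := CStarAlgebra.nonneg_iff_eq_star_mul_self.mp hR.posSemidef.nonneg
  have hB' : R = Bᵀ * B := by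
    rw [hB, Matrix.star_eq_conjTranspose, Matrix.conjTranspose_eq_transpose_of_trivial]
  have hdet : IsUnit B.det := by
    have h := (Matrix.isUnit_iff_isUnit_det _).mp hR.isUnit
    rw [hB', Matrix.det_mul] at h
    exact isUnit_of_mul_isUnit_right h
  -- With `R = Bᵀ B`, an upper bound for the form of `(B⁻¹)ᵀ B⁻¹` at `B x` reads `‖x‖² ≤ c xᵀ R x`.
  obtain ⟨c, hc, h⟩ := exists_form_le ((B⁻¹)ᵀ * B⁻¹)
  refine ⟨c⁻¹, inv_pos.mpr hc, fun x => ?_⟩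
  have hx := h (B *ᵥ x)
  rw [dotProduct_self_mulVec, Matrix.mulVec_mulVec, Matrix.nonsing_inv_mul _ hdet,
    Matrix.one_mulVec, ← dotProduct_self_mulVec, ← hB'] at hx
  rwa [inv_mul_le_iff₀ hc]

variable {q : ℕ → ℕ} {lam : ℝ} {R₀ : Matrix (Fin n) (Fin n) ℝ}
  {φ : ∀ k, Matrix (Fin (q k)) (Fin n) ℝ} {d : ∀ k, Fin (q k) → ℝ}

theorem isSymm_information (hR₀ : R₀.IsSymm) (k : ℕ) : (information lam R₀ φ k).IsSymm := by
  induction k with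
  | zero => exact hR₀
  | succ k ih =>
    exact (isSymm_siftedInformation lam ih).add
      (by rw [Matrix.IsSymm, Matrix.transpose_mul, Matrix.transpose_transpose])

/-- Uniform bounds on the information matrices; no excitation is needed. -/
theorem information_bounds {ε β : ℝ} (hlam : lam ∈ Set.Ioo (0 : ℝ) 1) (hε : 0 < ε)
    (hR₀ : R₀.PosDef) (hφ : ∀ k, φ k * (φ k)ᵀ = Matrix.diagonal (d k))
    (hd : ∀ k i, ε ≤ d k i) (hβ : ∀ k x, (φ k *ᵥ x) ⬝ᵥ (φ k *ᵥ x) ≤ β * (x ⬝ᵥ x)) :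
    ∃ a : ℝ, 0 < a ∧ ∃ c : ℝ, 0 < c ∧
      (∀ k x, a * (x ⬝ᵥ x) ≤ x ⬝ᵥ information lam R₀ φ k *ᵥ x) ∧
      ∀ k x, x ⬝ᵥ information lam R₀ φ k *ᵥ x ≤ c * (x ⬝ᵥ x) := by
  have hs₀ : R₀.IsSymm := isSymm_of_posDef hR₀
  have hl : 0 < 1 - lam := sub_pos.mpr hlam.2
  obtain ⟨a, ha, hRa⟩ := exists_le_form hR₀
  obtain ⟨c, hc, hRc⟩ := exists_form_le R₀
  -- The minimum meets both the initial bound and the condition under which one update preserves it;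
  -- the maximum below does the same from above.
  have ha' : 0 < min a (ε / (1 - lam)) := lt_min ha (div_pos hε hl)
  have haε : (1 - lam) * min a (ε / (1 - lam)) ≤ ε := by
    rw [mul_comm, ← le_div_iff₀ hl]
    exact min_le_right _ _
  have hcβ : β ≤ (1 - lam) * max c (β / (1 - lam)) := by
    rw [mul_comm, ← div_le_iff₀ hl]
    exact le_max_right _ _
  have hlow : ∀ k x, min a (ε / (1 - lam)) * (x ⬝ᵥ x) ≤ x ⬝ᵥ information lam R₀ φ k *ᵥ x := by
    intro k
    induction k with
    | zero =>
      exact fun x =>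
        (mul_le_mul_of_nonneg_right (min_le_left _ _) (dotProduct_self_nonneg' x)).trans (hRa x)
    | succ k ih =>
      exact le_update hlam (hφ k) hε (hd k) ha' haε (isSymm_information hs₀ k) ih
  refine ⟨_, ha', max c (β / (1 - lam)), lt_max_of_lt_left hc, hlow, fun k => ?_⟩
  induction k with
  | zero =>
    exact fun x =>
      (hRc x).trans (mul_le_mul_of_nonneg_right (le_max_left _ _) (dotProduct_self_nonneg' x))
  | succ k ih =>
    exact update_le hlam (hφ k) (fun i => hε.trans_le (hd k i)) (hβ k) hcβ
      (posDef_of_coercive (isSymm_information hs₀ k) ha' (hlow k)) ih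

theorem errorMap_decrease {a : ℝ} (hlam : lam ∈ Set.Ioo (0 : ℝ) 1) (hR₀ : R₀.PosDef)
    (hφ : ∀ k, φ k * (φ k)ᵀ = Matrix.diagonal (d k)) (hd : ∀ k i, 0 < d k i) (ha : 0 < a)
    (hR : ∀ k x, a * (x ⬝ᵥ x) ≤ x ⬝ᵥ information lam R₀ φ k *ᵥ x) (k : ℕ)
    (x : EuclideanSpace ℝ (Fin n)) :
    (errorMap lam R₀ φ k x).ofLp ⬝ᵥ
        information lam R₀ φ (k + 1) *ᵥ (errorMap lam R₀ φ k x).ofLp +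
      ‖Matrix.toEuclideanLin (φ k) (errorMap lam R₀ φ k x)‖ ^ 2 +
      lam * a * ‖x - errorMap lam R₀ φ k x‖ ^ 2 ≤ x.ofLp ⬝ᵥ information lam R₀ φ k *ᵥ x.ofLp := by
  have hs₀ : R₀.IsSymm := isSymm_of_posDef hR₀
  have hpd := posDef_of_coercive (isSymm_information hs₀ (k + 1)) ha (hR (k + 1))
  rw [← dotProduct_self_eq_norm_sq, ← dotProduct_self_eq_norm_sq]
  exact lyapunov_decrease hlam (mulVec_transpose_injective (hφ k) (hd k)) ha
    (isSymm_information hs₀ k) (hR k) ((Matrix.isUnit_iff_isUnit_det _).mp hpd.isUnit) rfl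

end Information

/-! ### Abstract discrete-time Lyapunov theorems. -/

section Lyapunov

theorem lyapunov_antitone {E : Type*} {f : ℕ → E → E} {V : ℕ → E → ℝ}
    (hV : ∀ k x, V (k + 1) (f k x) ≤ V k x) {k₀ : ℕ} {x : ℕ → E}
    (hx : IsTrajectoryFrom f k₀ x) {k l : ℕ} (hk : k₀ ≤ k) (hkl : k ≤ l) :
    V l (x l) ≤ V k (x k) := by
  induction l, hkl using Nat.le_induction with
  | base => exact le_rfl
  | succ l hl ih =>
    rw [hx l (hk.trans hl)]
    exact (hV l _).trans ih

variable {E : Type*} [NormedAddCommGroup E] {f : ℕ → E → E} {V : ℕ → E → ℝ} {a c : ℝ}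

theorem uniformlyLyapunovStable_of_lyapunov (hf : ∀ k, f k 0 = 0) (ha : 0 < a) (hc : 0 < c)
    (hVa : ∀ k x, a * ‖x‖ ^ 2 ≤ V k x) (hVc : ∀ k x, V k x ≤ c * ‖x‖ ^ 2)
    (hV : ∀ k x, V (k + 1) (f k x) ≤ V k x) : UniformlyLyapunovStable f := by
  refine ⟨hf, fun η hη => ⟨Real.sqrt (a / c) * η, by positivity, fun k₀ x hx hx0 k hk => ?_⟩⟩
  have h1 := (hVa k (x k)).trans ((lyapunov_antitone hV hx le_rfl hk).trans (hVc k₀ (x k₀)))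
  have h2 : ‖x k₀‖ ^ 2 < (Real.sqrt (a / c) * η) ^ 2 :=
    pow_lt_pow_left₀ hx0 (norm_nonneg _) two_ne_zero
  rw [mul_pow, Real.sq_sqrt (by positivity)] at h2
  have h3 : c * ‖x k₀‖ ^ 2 < a * η ^ 2 := by
    calc c * ‖x k₀‖ ^ 2 < c * (a / c * η ^ 2) := mul_lt_mul_of_pos_left h2 hc
      _ = a * η ^ 2 := by field_simp
  exact lt_of_pow_lt_pow_left₀ 2 hη.le (lt_of_mul_lt_mul_left (h1.trans_lt h3) ha.le)

theorem exists_one_lt_pow_mul_le {γ : ℝ} (hγ : γ < 1) (m : ℕ) :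
    ∃ b : ℝ, 1 < b ∧ (b ^ 2) ^ m * γ ≤ 1 := by
  have hcont : Filter.Tendsto (fun b : ℝ => (b ^ 2) ^ m * γ) (nhdsWithin 1 (Set.Ioi 1))
      (nhds ((1 ^ 2) ^ m * γ)) :=
    ((continuous_id.pow 2).pow m |>.mul continuous_const).continuousWithinAt.tendsto
  have hlt : ((1 : ℝ) ^ 2) ^ m * γ < 1 := by simpa using hγ
  obtain ⟨b, h1, h2⟩ := ((hcont.eventually_lt_const hlt).and self_mem_nhdsWithin).exists
  exact ⟨b, h2, h1.le⟩

theorem exponentiallyStable_of_contraction (hf : ∀ k, f k 0 = 0) (ha : 0 < a) (hc : 0 < c)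
    (hVa : ∀ k x, a * ‖x‖ ^ 2 ≤ V k x) (hVc : ∀ k x, V k x ≤ c * ‖x‖ ^ 2)
    (hV : ∀ k x, V (k + 1) (f k x) ≤ V k x) {m : ℕ} (hm : 0 < m) {γ : ℝ} (hγ : γ < 1)
    (hcon : ∀ k₀ x, IsTrajectoryFrom f k₀ x → ∀ k, k₀ ≤ k →
      V (k + m) (x (k + m)) ≤ γ * V k (x k)) :
    GloballyUniformlyExponentiallyStable f := by
  have hV0 : ∀ k x, 0 ≤ V k x := fun k x => le_trans (by positivity) (hVa k x)
  -- The factor `γ` may be negative, so `max γ 0` is iterated instead. The rate `b` is so close to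
  -- `1` that `b ^ (2 * m)` does not undo one contraction.
  obtain ⟨b, hb, hbγ⟩ := exists_one_lt_pow_mul_le (max_lt hγ zero_lt_one) m
  have hγ0 : 0 ≤ max γ 0 := le_max_right _ _
  have hb0 : 0 < b := zero_lt_one.trans hb
  refine ⟨hf, Real.sqrt (c / a * (b ^ 2) ^ m), by positivity, b, hb, fun k₀ x hx k hk => ?_⟩
  have hpow : ∀ j, V (k₀ + m * j) (x (k₀ + m * j)) ≤ max γ 0 ^ j * V k₀ (x k₀) := by
    intro j
    induction j with
    | zero => simp
    | succ j ih =>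
      have h := hcon k₀ x hx (k₀ + m * j) (Nat.le_add_right _ _)
      rw [Nat.mul_succ, ← Nat.add_assoc, pow_succ', mul_assoc]
      exact h.trans ((mul_le_mul_of_nonneg_right (le_max_left _ _) (hV0 _ _)).trans
        (mul_le_mul_of_nonneg_left ih hγ0))
  set t := k - k₀ with ht
  have hdiv : m * (t / m) + t % m = t := Nat.div_add_mod t m
  have h1 : V k (x k) ≤ max γ 0 ^ (t / m) * V k₀ (x k₀) :=
    (lyapunov_antitone hV hx (Nat.le_add_right k₀ (m * (t / m))) (by omega)).trans (hpow _)
  -- Full windows cost at most `1` each; the fewer than `m` leftover steps cost at most `(b ^ 2) ^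
  -- m`, absorbed into the overshoot constant.
  have h2 : (b ^ 2) ^ t * max γ 0 ^ (t / m) ≤ (b ^ 2) ^ m := by
    have hb2 : 1 ≤ b ^ 2 := one_le_pow₀ hb.le
    calc (b ^ 2) ^ t * max γ 0 ^ (t / m)
        = (b ^ 2) ^ (t % m) * ((b ^ 2) ^ m * max γ 0) ^ (t / m) := by
          rw [mul_pow, ← pow_mul (b ^ 2) m, ← mul_assoc, ← pow_add, add_comm (t % m), hdiv]
      _ ≤ (b ^ 2) ^ m * 1 := by
          gcongr
          · exact (Nat.mod_lt t hm).le
          · exact pow_le_one₀ (by positivity) hbγ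
      _ = (b ^ 2) ^ m := mul_one _
  rw [← div_eq_mul_inv, le_div_iff₀ (by positivity)]
  refine (sq_le_sq₀ (by positivity) (by positivity)).mp ?_
  rw [mul_pow, mul_pow, Real.sq_sqrt (by positivity), ← pow_mul, mul_comm t 2, pow_mul]
  have h3 := (hVa k (x k)).trans (h1.trans
    (mul_le_mul_of_nonneg_left (hVc k₀ (x k₀)) (by positivity)))
  have h4 : ‖x k‖ ^ 2 ≤ c / a * (max γ 0 ^ (t / m) * ‖x k₀‖ ^ 2) := by
    rw [div_mul_eq_mul_div, le_div_iff₀ ha]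
    linarith
  calc ‖x k‖ ^ 2 * (b ^ 2) ^ t
      ≤ c / a * (max γ 0 ^ (t / m) * ‖x k₀‖ ^ 2) * (b ^ 2) ^ t := by gcongr
    _ = c / a * ((b ^ 2) ^ t * max γ 0 ^ (t / m)) * ‖x k₀‖ ^ 2 := by ring
    _ ≤ c / a * (b ^ 2) ^ m * ‖x k₀‖ ^ 2 := by gcongr

/-- A Lyapunov function whose decrease controls both the increments of the state and a
uniformly observable output contracts over each excitation window. -/
theorem exponentiallyStable_of_excitation [NormedSpace ℝ E] {F : ℕ → Type*}
    [∀ k, NormedAddCommGroup (F k)] [∀ k, NormedSpace ℝ (F k)] {L : ∀ k, E →ₗ[ℝ] F k}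
    {B μ α : ℝ} {N : ℕ} (hf : ∀ k, f k 0 = 0) (ha : 0 < a) (hc : 0 < c)
    (hVa : ∀ k x, a * ‖x‖ ^ 2 ≤ V k x) (hVc : ∀ k x, V k x ≤ c * ‖x‖ ^ 2)
    (hB : 0 ≤ B) (hL : ∀ k x, ‖L k x‖ ≤ B * ‖x‖) (hμ : 0 < μ)
    (hV : ∀ k x, V (k + 1) (f k x) + ‖L k (f k x)‖ ^ 2 + μ * ‖x - f k x‖ ^ 2 ≤ V k x)
    (hα : 0 < α) (hPE : ∀ k x, α * ‖x‖ ^ 2 ≤ ∑ i ∈ Finset.Icc k (k + N), ‖L i x‖ ^ 2) :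
    GloballyUniformlyExponentiallyStable f := by
  have hV' : ∀ k x, V (k + 1) (f k x) ≤ V k x := fun k x => by
    have := hV k x
    have h1 : 0 ≤ μ * ‖x - f k x‖ ^ 2 := by positivity
    linarith [sq_nonneg ‖L k (f k x)‖]
  -- One unit of `√D` for the output itself, plus `B` times the drift accumulated over at most `N +
  -- 1` increments of size `√D / √μ`.
  set κ : ℝ := 1 + B * ((N + 1) / Real.sqrt μ) with hκ
  have hκ0 : 0 < κ := by positivity
  set K : ℝ := (N + 1) * κ ^ 2 with hK
  have hK0 : 0 < K := by positivity
  refine exponentiallyStable_of_contraction hf ha hc hVa hVc hV' (m := N + 1) (Nat.succ_pos N)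
    (γ := 1 - α / (c * K)) (by linarith [show 0 < α / (c * K) by positivity])
    fun k₀ x hx k hk => ?_
  set D := V k (x k) - V (k + (N + 1)) (x (k + (N + 1))) with hD
  -- Each dissipated term is at most the whole drop `D`. The output is seen at `x (i + 1)`, after
  -- the step, so the window needs `N + 1` steps to cover `N + 1` outputs.
  have hstep : ∀ i ∈ Finset.Icc k (k + N),
      ‖L i (x (i + 1))‖ ≤ Real.sqrt D ∧ ‖x i - x (i + 1)‖ ≤ Real.sqrt D / Real.sqrt μ := by
    intro i hi
    rw [Finset.mem_Icc] at hi
    have h1 := hV i (x i)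
    rw [← hx i (hk.trans hi.1)] at h1
    have h2 := lyapunov_antitone hV' hx hk hi.1
    have h3 : V (k + (N + 1)) (x (k + (N + 1))) ≤ V (i + 1) (x (i + 1)) :=
      lyapunov_antitone hV' hx (by omega) (by omega)
    have h4 : 0 ≤ μ * ‖x i - x (i + 1)‖ ^ 2 := by positivity
    constructor
    · apply Real.le_sqrt_of_sq_le
      linarith
    · rw [← Real.sqrt_div' _ hμ.le]
      apply Real.le_sqrt_of_sq_le
      rw [le_div_iff₀ hμ]
      linarith [sq_nonneg ‖L i (x (i + 1))‖]
  have hdist : ∀ j, j ≤ N + 1 → ‖x (k + j) - x k‖ ≤ j * (Real.sqrt D / Real.sqrt μ) := by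
    intro j
    induction j with
    | zero => simp
    | succ j ih =>
      intro hj
      have h1 := (hstep (k + j) (Finset.mem_Icc.mpr ⟨by omega, by omega⟩)).2
      rw [norm_sub_rev] at h1
      have h2 := norm_sub_le_norm_sub_add_norm_sub (x (k + j + 1)) (x (k + j)) (x k)
      have h3 := ih (by omega)
      rw [← Nat.add_assoc]
      push_cast
      linarith
  have hout : ∀ i ∈ Finset.Icc k (k + N), ‖L i (x k)‖ ^ 2 ≤ κ ^ 2 * D := by
    intro i hi
    have hi' := Finset.mem_Icc.mp hi
    have h0 := (hstep i hi).1
    have hD0 : 0 ≤ D := sub_nonneg.mpr (lyapunov_antitone hV' hx hk (by omega))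
    have h1 := hdist (i + 1 - k) (by omega)
    rw [show k + (i + 1 - k) = i + 1 by omega] at h1
    have h2 : ((i + 1 - k : ℕ) : ℝ) ≤ N + 1 := by
      exact_mod_cast (by omega : i + 1 - k ≤ N + 1)
    have h3 : ‖x (i + 1) - x k‖ ≤ (N + 1) * (Real.sqrt D / Real.sqrt μ) :=
      h1.trans (mul_le_mul_of_nonneg_right h2 (by positivity))
    have h4 : ‖L i (x k)‖ ≤ κ * Real.sqrt D := by
      -- Linearity moves the output from the state `x (i + 1)` back to the fixed state `x k`, the
      -- one to which excitation applies.
      have h5 : L i (x k) = L i (x (i + 1)) - L i (x (i + 1) - x k) := by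
        rw [map_sub, sub_sub_cancel]
      calc ‖L i (x k)‖ ≤ ‖L i (x (i + 1))‖ + ‖L i (x (i + 1) - x k)‖ := by
            rw [h5]
            exact norm_sub_le _ _
        _ ≤ Real.sqrt D + B * ((N + 1) * (Real.sqrt D / Real.sqrt μ)) :=
            add_le_add h0 ((hL i _).trans (mul_le_mul_of_nonneg_left h3 hB))
        _ = κ * Real.sqrt D := by rw [hκ]; ring
    calc ‖L i (x k)‖ ^ 2 ≤ (κ * Real.sqrt D) ^ 2 := pow_le_pow_left₀ (norm_nonneg _) h4 2
      _ = κ ^ 2 * D := by rw [mul_pow, Real.sq_sqrt hD0]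
  have hsum := (hPE k (x k)).trans (Finset.sum_le_card_nsmul _ _ _ hout)
  rw [Nat.card_Icc, show k + N + 1 - k = N + 1 by omega, nsmul_eq_mul, ← mul_assoc] at hsum
  push_cast at hsum
  have hVD : α / (c * K) * V k (x k) ≤ D := by
    rw [div_mul_eq_mul_div, div_le_iff₀ (by positivity)]
    have h1 := mul_le_mul_of_nonneg_left (hVc k (x k)) hα.le
    have h2 := mul_le_mul_of_nonneg_left hsum hc.le
    rw [← hK] at h2
    linarith
  linarith

end Lyapunov

/-! ### Error dynamics for noise-free measurements. -/

section ErrorSystem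

variable {p n : ℕ}

theorem filteredMeasurement_eq {φ : Matrix (Fin p) (Fin n) ℝ} (S : CompactSVD φ) (ε : ℝ)
    (θ : EuclideanSpace ℝ (Fin n)) :
    filteredMeasurement S ε (Matrix.toEuclideanLin φ θ) =
      Matrix.toEuclideanLin (filteredRegressor S ε) θ := by
  simp [filteredMeasurement, filteredRegressor, Matrix.toLpLin_apply]

theorem estimate_error_isTrajectory {q : ℕ → ℕ} (lam : ℝ) (R₀ : Matrix (Fin n) (Fin n) ℝ)
    (φ : ∀ k, Matrix (Fin (q k)) (Fin n) ℝ) (y : ∀ k, EuclideanSpace ℝ (Fin (q k)))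
    (θ₀ θ : EuclideanSpace ℝ (Fin n)) (hy : ∀ k, y k = Matrix.toEuclideanLin (φ k) θ) :
    IsTrajectoryFrom (errorMap lam R₀ φ) 0 fun k => estimate lam R₀ φ y θ₀ k - θ := by
  intro k _
  simp only [estimate, errorMap, hy]
  generalize estimate lam R₀ φ y θ₀ k = z
  rw [← map_sub]
  apply WithLp.ofLp_injective 2
  simp only [Matrix.toLpLin_apply, WithLp.ofLp_sub, WithLp.ofLp_add, Matrix.sub_mulVec,
    Matrix.one_mulVec, Matrix.mulVec_sub, Matrix.mulVec_mulVec]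
  abel

end ErrorSystem

end SIFt

theorem mainTheorem2 {p n : ℕ} (lam ε : ℝ) (hlam : lam ∈ Set.Ioo (0 : ℝ) 1) (hε : 0 < ε)
    (R₀ : Matrix (Fin n) (Fin n) ℝ) (hR₀ : R₀.PosDef)
    (θ₀ : EuclideanSpace ℝ (Fin n))
    (φ : ℕ → Matrix (Fin p) (Fin n) ℝ) (hφ : SIFt.BoundedRegressors φ)
    (S : ∀ k, SIFt.CompactSVD (φ k))
    (y : ℕ → EuclideanSpace ℝ (Fin p)) (θ : EuclideanSpace ℝ (Fin n))
    (hy : ∀ k, y k = Matrix.toEuclideanLin (φ k) θ) :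
    SIFt.IsTrajectoryFrom
        (SIFt.errorMap lam R₀ (fun k => SIFt.filteredRegressor (S k) ε)) 0
        (fun k =>
          SIFt.estimate lam R₀ (fun k => SIFt.filteredRegressor (S k) ε)
            (fun k => SIFt.filteredMeasurement (S k) ε (y k)) θ₀ k - θ) ∧
      SIFt.UniformlyLyapunovStable
        (SIFt.errorMap lam R₀ (fun k => SIFt.filteredRegressor (S k) ε)) ∧
      (SIFt.PersistentlyExciting (fun k => SIFt.filteredRegressor (S k) ε) →
        SIFt.GloballyUniformlyExponentiallyStable
          (SIFt.errorMap lam R₀ (fun k => SIFt.filteredRegressor (S k) ε))) := by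
  obtain ⟨β, hβ, hφβ⟩ := hφ
  have hdiag := fun k => SIFt.filteredRegressor_mul_transpose (S k) ε
  have hd := fun k => SIFt.le_sq_σ_castLE (S k) ε
  have hbd := fun k => SIFt.filteredRegressor_mulVec_le (S k) ε (hφβ k)
  obtain ⟨a, ha, c, hc, hlow, hup⟩ := SIFt.information_bounds hlam hε hR₀ hdiag hd hbd
  have hdec := SIFt.errorMap_decrease hlam hR₀ hdiag (fun k i => hε.trans_le (hd k i)) ha hlow
  have hf : ∀ k, SIFt.errorMap lam R₀ (fun k => SIFt.filteredRegressor (S k) ε) k 0 = 0 :=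
    fun k => map_zero _
  have hμ : 0 < lam * a := mul_pos hlam.1 ha
  let V : ℕ → EuclideanSpace ℝ (Fin n) → ℝ := fun k x =>
    x.ofLp ⬝ᵥ SIFt.information lam R₀ (fun k => SIFt.filteredRegressor (S k) ε) k *ᵥ x.ofLp
  have hVa : ∀ k x, a * ‖x‖ ^ 2 ≤ V k x := fun k x => by
    rw [← SIFt.dotProduct_self_eq_norm_sq]
    exact hlow k x.ofLp
  have hVc : ∀ k x, V k x ≤ c * ‖x‖ ^ 2 := fun k x => by
    rw [← SIFt.dotProduct_self_eq_norm_sq]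
    exact hup k x.ofLp
  refine ⟨SIFt.estimate_error_isTrajectory lam R₀ _ _ θ₀ θ fun k => ?_,
    SIFt.uniformlyLyapunovStable_of_lyapunov (V := V) hf ha hc hVa hVc fun k x => ?_, ?_⟩
  · rw [hy k, SIFt.filteredMeasurement_eq]
  · have h := hdec k x
    refine le_trans ?_ h
    rw [add_assoc]
    exact le_add_of_nonneg_right (by positivity)
  · rintro ⟨N, -, α, hα, hPE⟩
    refine SIFt.exponentiallyStable_of_excitation (V := V)
      (L := fun k => Matrix.toEuclideanLin (SIFt.filteredRegressor (S k) ε)) (N := N)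
      hf ha hc hVa hVc (Real.sqrt_nonneg β) (fun k x => ?_) hμ hdec hα fun k x => ?_
    · refine (sq_le_sq₀ (norm_nonneg _) (by positivity)).mp ?_
      rw [mul_pow, Real.sq_sqrt hβ.le, ← SIFt.dotProduct_self_eq_norm_sq,
        ← SIFt.dotProduct_self_eq_norm_sq]
      exact hbd k x.ofLp
    · have h := (hPE k).dotProduct_mulVec_nonneg x.ofLp
      rw [star_trivial, Matrix.sub_mulVec, dotProduct_sub, Matrix.smul_mulVec, Matrix.one_mulVec,
        dotProduct_smul, Matrix.sum_mulVec, dotProduct_sum, sub_nonneg,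
        SIFt.dotProduct_self_eq_norm_sq, smul_eq_mul] at h
      refine h.trans_eq (Finset.sum_congr rfl fun i _ => ?_)
      rw [SIFt.dotProduct_self_mulVec, ← SIFt.dotProduct_self_eq_norm_sq]
      rfl
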